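/- Let $n\ge 1$ and let $\mathcal{H}_n$ be the set of monic polynomials of degree $n$ all of whose complex zeros are real. For a polynomial $P$ let $Z(P)$ be the unordered tuple of its zeros, counted with multiplicity, and for $\lambda\in\mathbb{R}$ let $D_\lambda=\bigl(1-\lambda\frac{d}{dx}\bigr)e^{\lambda\frac{d}{dx}}$, that is, $(D_\lambda P)(x)=P(x+\lambda)-\lambda P'(x+\lambda)$. Let $P\in\mathcal{H}_n$. Then $D_\lambda P\in\mathcal{H}_n$ for every $\lambda\in\mathbb{R}$, so that $\max Z(D_\lambda P)$ and $\min Z(D_\lambda P)$ are defined, and: (1) the map $\lambda\mapsto\max Z(D_\lambda P)$ is convex on $\mathbb{R}$ and has a global minimum at $\lambda=0$; (2) the map $\lambda\mapsto\min Z(D_\lambda P)$ is concave on $\mathbb{R}$ and has a global maximum at $\lambda=0$; (3) consequently, the spread $\lambda\mapsto\max Z(D_\lambda P)-\min Z(D_\lambda P)$ is convex on $\mathbb{R}$ and has a global minimum at $\lambda=0$. -/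

import Mathlib

open Polynomial

namespace Hyperbolic

/-- The unordered tuple `Z(P)` of complex zeros of `P`, counted with multiplicity. -/
noncomputable def Z (P : ℂ[X]) : Multiset ℂ := P.roots

/-- The set `H n` of monic hyperbolic polynomials of degree `n`: all complex zeros are real. -/
def H (n : ℕ) : Set ℂ[X] :=
  {P | P.Monic ∧ P.natDegree = n ∧ ∀ z ∈ Z P, z.im = 0}

/-- The operator `exp (lam d/dx)` on polynomials, given by its exponential series
(all derivatives of order above the degree vanish). -/
noncomputable def expDeriv (lam : ℝ) (P : ℂ[X]) : ℂ[X] :=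
  ∑ k ∈ Finset.range (P.natDegree + 1),
    C ((lam : ℂ) ^ k / (k.factorial : ℂ)) * (derivative^[k] P)

/-- The exponential of `lam d/dx` is the translation `P(x) ↦ P(x + lam)`. -/
theorem expDeriv_eq_comp (lam : ℝ) (P : ℂ[X]) :
    expDeriv lam P = P.comp (X + C (lam : ℂ)) := by
  apply Polynomial.funext
  intro z
  have h : ∀ k, (derivative^[k] P).eval z
      = (k.factorial : ℂ) * ((hasseDeriv k P).eval z) := by
    intro k
    rw [← factorial_smul_hasseDeriv]
    simp
  have h2 : (P.comp (X + C (lam : ℂ))).eval z = (taylor z P).eval (lam : ℂ) := by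
    simp [taylor_apply, add_comm]
  rw [h2, eval_eq_sum_range (p := taylor z P), natDegree_taylor, expDeriv, eval_finsetSum]
  refine Finset.sum_congr rfl fun k _ => ?_
  have hk : (k.factorial : ℂ) ≠ 0 := by exact_mod_cast k.factorial_ne_zero
  rw [eval_mul, eval_C, h, taylor_coeff]
  field_simp

/-- The operator `D lam = (1 - lam d/dx) exp (lam d/dx)`. -/
noncomputable def D (lam : ℝ) (P : ℂ[X]) : ℂ[X] :=
  expDeriv lam P - C (lam : ℂ) * derivative (expDeriv lam P)

/-- The largest real zero of `P`, that is `max Z(P)` when `P` is hyperbolic of degree `≥ 1`. -/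
noncomputable def maxZ (P : ℂ[X]) : ℝ := sSup {x : ℝ | (x : ℂ) ∈ Z P}

/-- The smallest real zero of `P`, that is `min Z(P)` when `P` is hyperbolic of degree `≥ 1`. -/
noncomputable def minZ (P : ℂ[X]) : ℝ := sInf {x : ℝ | (x : ℂ) ∈ Z P}

theorem finite_realZeros (P : ℂ[X]) : {x : ℝ | (x : ℂ) ∈ Z P}.Finite := by
  refine Set.Finite.preimage (f := fun x : ℝ => (x : ℂ))
    (fun a _ b _ hab => Complex.ofReal_injective hab) (s := {z : ℂ | z ∈ Z P}) ?_
  exact (Z P).toFinset.finite_toSet.subset fun z hz => by simpa using hz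

theorem nonempty_realZeros {n : ℕ} (hn : 1 ≤ n) {P : ℂ[X]} (hP : P ∈ H n) :
    {x : ℝ | (x : ℂ) ∈ Z P}.Nonempty := by
  obtain ⟨hm, hd, hr⟩ := hP
  obtain ⟨z, hz⟩ := IsAlgClosed.exists_root P
    (natDegree_pos_iff_degree_pos.1 (by omega)).ne'
  have hzZ : z ∈ Z P := (mem_roots hm.ne_zero).2 hz
  refine ⟨z.re, ?_⟩
  have : ((z.re : ℝ) : ℂ) = z := Complex.ext (by simp) (by simp [hr z hzZ])
  simpa [this] using hzZ

/-- For hyperbolic `P` of positive degree, `maxZ P` really is the maximum of `Z(P)`. -/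
theorem isGreatest_maxZ {n : ℕ} (hn : 1 ≤ n) {P : ℂ[X]} (hP : P ∈ H n) :
    IsGreatest {x : ℝ | (x : ℂ) ∈ Z P} (maxZ P) :=
  ⟨(nonempty_realZeros hn hP).csSup_mem (finite_realZeros P),
    fun _ hx => le_csSup (finite_realZeros P).bddAbove hx⟩

/-- For hyperbolic `P` of positive degree, `minZ P` really is the minimum of `Z(P)`. -/
theorem isLeast_minZ {n : ℕ} (hn : 1 ≤ n) {P : ℂ[X]} (hP : P ∈ H n) :
    IsLeast {x : ℝ | (x : ℂ) ∈ Z P} (minZ P) :=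
  ⟨(nonempty_realZeros hn hP).csInf_mem (finite_realZeros P),
    fun _ hx => csInf_le (finite_realZeros P).bddBelow hx⟩

end Hyperbolic

/-!
The proof realises `D lam P` as the characteristic polynomial of a Hermitian matrix that depends
affinely on `lam`. If `P = ∏ (X - x i)` with `x i` real, put
`A lam = diag x + lam • (J - 1)`, where `J` is the all-ones matrix. As `J` has rank one, the matrix
determinant lemma gives, with `y = z + lam`,
`det (z - A lam) = det (y - diag x - lam • J) = P y - lam * P' y = (D lam P) z`,
which is `charpoly_diagonalPencil`. Hence all zeros of `D lam P` are eigenvalues of the Hermitian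
matrix `A lam`, and so are real.

A real number `M` bounds the zeros from above if and only if `M • 1 - A lam` is positive
semidefinite (`posSemidef_smul_one_sub_iff`), and similarly from below. Positive semidefiniteness is
preserved by convex combinations and `A` is affine, so the largest zero is convex and the smallest
one is concave in `lam`. Since `J - 1` vanishes on the diagonal, the diagonal of `A lam` is `x`
for every `lam`. A positive semidefinite matrix has nonnegative diagonal, so the largest zero of
`D lam P` is at least every `x i`, and the smallest is at most every `x i`, with equality to the
extreme `x i` at `lam = 0`, where `D 0 P = P`.
-/

namespace Hyperbolic

open Matrix
open scoped ComplexOrder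

variable {ι : Type*} [DecidableEq ι]

/-- The Hermitian pencil `diag x + lam • (J - 1)`, with `J` the all-ones matrix. -/
noncomputable def diagonalPencil (x : ι → ℝ) (lam : ℝ) : Matrix ι ι ℂ :=
  diagonal (fun i => (x i : ℂ)) + (lam : ℂ) • (of (fun _ _ => 1) - 1)

theorem isHermitian_diagonalPencil (x : ι → ℝ) (lam : ℝ) :
    (diagonalPencil x lam).IsHermitian := by
  ext i j
  by_cases h : i = j
  · subst h; simp [diagonalPencil]
  · simp [diagonalPencil, h, Ne.symm h]

theorem diagonalPencil_apply_self (x : ι → ℝ) (lam : ℝ) (i : ι) :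
    diagonalPencil x lam i i = x i := by
  simp [diagonalPencil]

theorem diagonalPencil_convexComb (x : ι → ℝ) (s t : ℝ) {a b : ℝ} (hab : a + b = 1) :
    diagonalPencil x (a * s + b * t) =
      (a : ℂ) • diagonalPencil x s + (b : ℂ) • diagonalPencil x t := by
  have h : (a : ℂ) + b = 1 := by exact_mod_cast hab
  have hd : diagonal (fun i => (x i : ℂ)) =
      ((a : ℂ) + b) • diagonal (fun i => (x i : ℂ)) := by rw [h, one_smul]
  simp only [diagonalPencil]
  conv_lhs => rw [hd]
  push_cast
  module

theorem isHermitian_ofReal_smul_one (M : ℝ) :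
    ((M : ℂ) • (1 : Matrix ι ι ℂ)).IsHermitian := by
  simp [IsHermitian, conjTranspose_smul]

variable [Fintype ι]

theorem ofReal_mem_Z_charpoly_iff (A : Matrix ι ι ℂ) (x : ℝ) :
    (x : ℂ) ∈ Z A.charpoly ↔ x ∈ spectrum ℝ A := by
  rw [Z, mem_roots (charpoly_monic A).ne_zero, ← mem_spectrum_iff_isRoot_charpoly,
    ← spectrum.algebraMap_mem_iff ℂ]
  rfl

theorem posSemidef_iff_real_spectrum_nonneg {A : Matrix ι ι ℂ} (hA : A.IsHermitian) :
    A.PosSemidef ↔ ∀ y ∈ spectrum ℝ A, 0 ≤ y := by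
  rw [hA.posSemidef_iff_eigenvalues_nonneg, hA.spectrum_real_eq_range_eigenvalues]
  simp [Pi.le_def]

theorem algebraMap_real_eq_smul_one (M : ℝ) :
    algebraMap ℝ (Matrix ι ι ℂ) M = (M : ℂ) • 1 := by
  ext i j
  simp [algebraMap_matrix_apply, Matrix.one_apply]

/-- The real zeros of the characteristic polynomial of a Hermitian matrix are at most `M` exactly
when `M • 1 - A` is positive semidefinite. -/
theorem posSemidef_smul_one_sub_iff {A : Matrix ι ι ℂ} (hA : A.IsHermitian) (M : ℝ) :
    ((M : ℂ) • (1 : Matrix ι ι ℂ) - A).PosSemidef ↔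
      ∀ x : ℝ, (x : ℂ) ∈ Z A.charpoly → x ≤ M := by
  rw [posSemidef_iff_real_spectrum_nonneg ((isHermitian_ofReal_smul_one M).sub hA),
    ← algebraMap_real_eq_smul_one, ← spectrum.singleton_sub_eq]
  simp [ofReal_mem_Z_charpoly_iff]

/-- The real zeros of the characteristic polynomial of a Hermitian matrix are at least `m` exactly
when `A - m • 1` is positive semidefinite. -/
theorem posSemidef_sub_smul_one_iff {A : Matrix ι ι ℂ} (hA : A.IsHermitian) (m : ℝ) :
    (A - (m : ℂ) • (1 : Matrix ι ι ℂ)).PosSemidef ↔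
      ∀ x : ℝ, (x : ℂ) ∈ Z A.charpoly → m ≤ x := by
  rw [posSemidef_iff_real_spectrum_nonneg (hA.sub (isHermitian_ofReal_smul_one m)),
    ← algebraMap_real_eq_smul_one, ← spectrum.sub_singleton_eq]
  simp [ofReal_mem_Z_charpoly_iff]

theorem charpoly_mem_H {n : ℕ} {A : Matrix (Fin n) (Fin n) ℂ} (hA : A.IsHermitian) :
    A.charpoly ∈ H n := by
  refine ⟨charpoly_monic A, by simp [charpoly_natDegree_eq_dim], fun z hz => ?_⟩
  rw [Z, hA.roots_charpoly_eq_eigenvalues] at hz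
  simp only [Multiset.mem_map] at hz
  obtain ⟨i, -, rfl⟩ := hz
  simp

/-- Rank-one perturbation of an invertible diagonal matrix by a multiple of the all-ones matrix. -/
theorem det_diagonal_sub_smul_ones {K : Type*} [Field K] (d : ι → K) (hd : ∀ i, d i ≠ 0) (c : K) :
    (diagonal d - c • (of (fun _ _ => 1) : Matrix ι ι K)).det =
      ∏ i, d i - c * ∑ i, ∏ j ∈ Finset.univ.erase i, d j := by
  have h : diagonal d - c • (of (fun _ _ => 1) : Matrix ι ι K) =
      diagonal d * (1 + replicateCol Unit (fun i => -c * (d i)⁻¹) *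
        replicateRow Unit (fun _ => (1 : K))) := by
    ext i j
    rw [diagonal_mul]
    by_cases hij : i = j
    · subst hij
      simp [Matrix.mul_apply, mul_add, mul_left_comm, hd, sub_eq_add_neg]
    · simp [Matrix.mul_apply, hij, mul_left_comm, hd]
  rw [h, det_mul, det_diagonal, det_one_add_replicateCol_mul_replicateRow]
  have hi : ∀ i, ∏ j ∈ Finset.univ.erase i, d j = (∏ j, d j) * (d i)⁻¹ := fun i => by
    rw [← Finset.prod_erase_mul _ _ (Finset.mem_univ i), mul_inv_cancel_right₀ (hd i)]
  simp only [dotProduct, hi, one_mul, ← Finset.mul_sum]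
  ring

theorem eval_D (lam : ℝ) (P : ℂ[X]) (z : ℂ) :
    (D lam P).eval z = P.eval (z + lam) - lam * (derivative P).eval (z + lam) := by
  simp [D, expDeriv_eq_comp, derivative_comp]

theorem D_zero (P : ℂ[X]) : D 0 P = P := by
  simp [D, expDeriv_eq_comp]

theorem charpoly_diagonalPencil (x : ι → ℝ) (lam : ℝ) :
    (diagonalPencil x lam).charpoly = D lam (∏ i, (X - C (x i : ℂ))) := by
  -- The determinant lemma needs an invertible diagonal, which excludes finitely many `z`.
  refine Polynomial.eq_of_infinite_eval_eq _ _
    ((Set.Finite.infinite_compl (Set.finite_range fun i => (x i : ℂ) - lam)).mono fun z hz => ?_)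
  have hd : ∀ i, z + lam - (x i : ℂ) ≠ 0 := fun i h =>
    hz ⟨i, by linear_combination -h⟩
  have hmat : scalar ι z - diagonalPencil x lam =
      diagonal (fun i => z + lam - (x i : ℂ)) - (lam : ℂ) • of (fun _ _ => 1) := by
    ext i j
    by_cases h : i = j
    · subst h; simp [diagonalPencil]; ring
    · simp [diagonalPencil, h]
  rw [Set.mem_ofPred_eq, eval_charpoly, hmat, det_diagonal_sub_smul_ones _ hd, eval_D,
    derivative_prod_finset]
  simp [eval_prod, eval_finsetSum]

theorem exists_eq_prod_of_mem_H {n : ℕ} {P : ℂ[X]} (hP : P ∈ H n) :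
    ∃ x : Fin n → ℝ, P = ∏ i, (X - C (x i : ℂ)) := by
  obtain ⟨hm, hd, hr⟩ := hP
  have hs : P.Splits := IsAlgClosed.splits P
  have hlen : P.roots.toList.length = n := by
    rw [Multiset.length_toList, ← hd, hs.natDegree_eq_card_roots]
  subst hlen
  refine ⟨fun i => (P.roots.toList.get i).re, ?_⟩
  have hreal : ∀ i, (((P.roots.toList.get i).re : ℝ) : ℂ) = P.roots.toList.get i := fun i =>
    Complex.ext (by simp) (by
      simpa using (hr _ (Multiset.mem_toList.1 (List.get_mem P.roots.toList i))).symm)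
  simp only [hreal]
  conv_lhs => rw [hs.eq_prod_roots_of_monic hm, ← Multiset.coe_toList P.roots]
  have hget : (fun i => X - C (P.roots.toList.get i)) =
      (fun a => X - C a) ∘ P.roots.toList.get := rfl
  rw [Multiset.map_coe, Multiset.prod_coe, ← List.prod_ofFn, hget, ← List.map_ofFn, List.ofFn_get]

end Hyperbolic

open scoped ComplexOrder in
theorem theorem6 (n : ℕ) (hn : 1 ≤ n) (P : ℂ[X]) (hP : P ∈ Hyperbolic.H n) :
    (∀ lam : ℝ, Hyperbolic.D lam P ∈ Hyperbolic.H n) ∧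
    (ConvexOn ℝ Set.univ (fun lam : ℝ => Hyperbolic.maxZ (Hyperbolic.D lam P)) ∧
      ∀ lam : ℝ, Hyperbolic.maxZ (Hyperbolic.D 0 P) ≤ Hyperbolic.maxZ (Hyperbolic.D lam P)) ∧
    (ConcaveOn ℝ Set.univ (fun lam : ℝ => Hyperbolic.minZ (Hyperbolic.D lam P)) ∧
      ∀ lam : ℝ, Hyperbolic.minZ (Hyperbolic.D lam P) ≤ Hyperbolic.minZ (Hyperbolic.D 0 P)) ∧
    (ConvexOn ℝ Set.univ (fun lam : ℝ =>
        Hyperbolic.maxZ (Hyperbolic.D lam P) - Hyperbolic.minZ (Hyperbolic.D lam P)) ∧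
      ∀ lam : ℝ,
        Hyperbolic.maxZ (Hyperbolic.D 0 P) - Hyperbolic.minZ (Hyperbolic.D 0 P) ≤
          Hyperbolic.maxZ (Hyperbolic.D lam P) - Hyperbolic.minZ (Hyperbolic.D lam P)) := by
  obtain ⟨x, hx⟩ := Hyperbolic.exists_eq_prod_of_mem_H hP
  have hD : ∀ lam, Hyperbolic.D lam P = (Hyperbolic.diagonalPencil x lam).charpoly := fun lam => by
    rw [Hyperbolic.charpoly_diagonalPencil, ← hx]
  have hherm := Hyperbolic.isHermitian_diagonalPencil x
  have hH : ∀ lam, Hyperbolic.D lam P ∈ Hyperbolic.H n := fun lam => by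
    rw [hD]; exact Hyperbolic.charpoly_mem_H (hherm lam)
  have hmaxG := fun lam => Hyperbolic.isGreatest_maxZ hn (hH lam)
  have hminL := fun lam => Hyperbolic.isLeast_minZ hn (hH lam)
  have hmaxPSD : ∀ lam M : ℝ, Hyperbolic.maxZ (Hyperbolic.D lam P) ≤ M ↔
      ((M : ℂ) • (1 : Matrix (Fin n) (Fin n) ℂ) -
        Hyperbolic.diagonalPencil x lam).PosSemidef := fun lam M => by
    rw [Hyperbolic.posSemidef_smul_one_sub_iff (hherm lam), ← hD]
    exact isLUB_le_iff (hmaxG lam).isLUB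
  have hminPSD : ∀ lam m : ℝ, m ≤ Hyperbolic.minZ (Hyperbolic.D lam P) ↔
      (Hyperbolic.diagonalPencil x lam -
        (m : ℂ) • (1 : Matrix (Fin n) (Fin n) ℂ)).PosSemidef := fun lam m => by
    rw [Hyperbolic.posSemidef_sub_smul_one_iff (hherm lam), ← hD]
    exact le_isGLB_iff (hminL lam).isGLB
  -- Every zero of `P` is a diagonal entry of each matrix of the pencil.
  have hzero : ∀ y : ℝ, (y : ℂ) ∈ Hyperbolic.Z (Hyperbolic.D 0 P) → ∃ i, x i = y := by
    intro y hy
    rw [Hyperbolic.D_zero, Hyperbolic.Z, hx] at hy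
    have h := (mem_roots'.1 hy).2
    rw [IsRoot.def, eval_prod, Finset.prod_eq_zero_iff] at h
    obtain ⟨i, -, hi⟩ := h
    refine ⟨i, ?_⟩
    simp only [eval_sub, eval_X, eval_C, sub_eq_zero] at hi
    exact_mod_cast hi.symm
  have hmax0 : ∀ lam : ℝ, Hyperbolic.maxZ (Hyperbolic.D 0 P) ≤
      Hyperbolic.maxZ (Hyperbolic.D lam P) := fun lam => by
    obtain ⟨i, hi⟩ := hzero _ (hmaxG 0).1
    have h := ((hmaxPSD lam _).1 le_rfl).diag_nonneg (i := i)
    rw [Matrix.sub_apply, Hyperbolic.diagonalPencil_apply_self, hi] at h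
    simpa [← Complex.ofReal_sub] using h
  have hmin0 : ∀ lam : ℝ, Hyperbolic.minZ (Hyperbolic.D lam P) ≤
      Hyperbolic.minZ (Hyperbolic.D 0 P) := fun lam => by
    obtain ⟨i, hi⟩ := hzero _ (hminL 0).1
    have h := ((hminPSD lam _).1 le_rfl).diag_nonneg (i := i)
    rw [Matrix.sub_apply, Hyperbolic.diagonalPencil_apply_self, hi] at h
    simpa [← Complex.ofReal_sub] using h
  have hconv : ConvexOn ℝ Set.univ
      (fun lam : ℝ => Hyperbolic.maxZ (Hyperbolic.D lam P)) := by
    refine ⟨convex_univ, fun s _ t _ a b ha hb hab => ?_⟩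
    simp only [smul_eq_mul]
    rw [hmaxPSD]
    have hs := ((hmaxPSD s _).1 le_rfl).smul (show (0 : ℂ) ≤ a by exact_mod_cast ha)
    have ht := ((hmaxPSD t _).1 le_rfl).smul (show (0 : ℂ) ≤ b by exact_mod_cast hb)
    convert hs.add ht using 1
    rw [Hyperbolic.diagonalPencil_convexComb x s t hab]
    push_cast
    module
  have hconc : ConcaveOn ℝ Set.univ
      (fun lam : ℝ => Hyperbolic.minZ (Hyperbolic.D lam P)) := by
    refine ⟨convex_univ, fun s _ t _ a b ha hb hab => ?_⟩
    simp only [smul_eq_mul]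
    rw [hminPSD]
    have hs := ((hminPSD s _).1 le_rfl).smul (show (0 : ℂ) ≤ a by exact_mod_cast ha)
    have ht := ((hminPSD t _).1 le_rfl).smul (show (0 : ℂ) ≤ b by exact_mod_cast hb)
    convert hs.add ht using 1
    rw [Hyperbolic.diagonalPencil_convexComb x s t hab]
    push_cast
    module
  exact ⟨hH, ⟨hconv, hmax0⟩, ⟨hconc, hmin0⟩, hconv.sub hconc,
    fun lam => sub_le_sub (hmax0 lam) (hmin0 lam)⟩
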